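/- Let $\tilde I=\mathrm{diag}(1,1,-1,-1)$ and let $\mathbb{R}^{7,7}$ be $\mathbb{R}^{14}=\mathbb{R}^5\oplus\mathbb{R}^4\oplus\mathbb{R}^5$ with the scalar product $\langle\cdot,\cdot\rangle$ given by the matrix $$Q=\begin{pmatrix}0&0&I_5\\0&\tilde I&0\\I_5&0&0\end{pmatrix},$$ which has signature $(7,7)$. Let $\mathrm{Iso}(\mathbb{R}^{7,7})$ be the group of affine transformations of $\mathbb{R}^{14}$ whose linear part preserves $\langle\cdot,\cdot\rangle$. Let $\Gamma_{7,7}$ be the group generated by the two affine transformations $\gamma_i$ ($i=1,2$) with linear part and translation part $$\begin{pmatrix}I_5&-B_i^\top\tilde I&C_i\\0&I_4&B_i\\0&0&I_5\end{pmatrix},\qquad\begin{pmatrix}0\\0\\u_i^*\end{pmatrix},$$ where $$B_1=\begin{pmatrix}-1&0&0&0&0\\0&-1&0&0&0\\0&-1&0&0&0\\-1&0&0&0&0\end{pmatrix},\quad B_2=\begin{pmatrix}0&-1&0&0&0\\1&0&0&0&0\\-1&0&0&0&0\\0&1&0&0&0\end{pmatrix},$$ the only nonzero entries of $C_1\in\mathbb{R}^{5\times5}$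 are $(C_1)_{35}=-1$ and $(C_1)_{53}=1$, the only nonzero entries of $C_2\in\mathbb{R}^{5\times5}$ are $(C_2)_{45}=-1$ and $(C_2)_{54}=1$, and $u_1^*=(0,0,0,-1,0)^\top$, $u_2^*=(0,0,1,0,0)^\top$. Then $\Gamma_{7,7}$ is a subgroup of $\mathrm{Iso}(\mathbb{R}^{7,7})$ isomorphic to the discrete Heisenberg group (the integral unipotent upper triangular $3\times3$ matrices), the centralizer of $\Gamma_{7,7}$ in $\mathrm{Iso}(\mathbb{R}^{7,7})$ acts transitively on $\mathbb{R}^{7,7}$, and $\Gamma_{7,7}$ acts freely and properly discontinuously on $\mathbb{R}^{7,7}$. The linear holonomy group $\mathrm{hol}(\Gamma_{7,7})$, that is, the group of linear parts of the elements of $\Gamma_{7,7}$, is not abelian. The quotient $M=\mathbb{R}^{7,7}/\Gamma_{7,7}$ is a connected Hausdorff second countable space, and it carries the structure of a smooth $14$-manifold with a smooth pseudo-Riemannian metric for which the projection $\mathbb{R}^{7,7}\to M$ is a local diffeomorphism and a local isometry; this metric has signature $(7,7)$, is flat (the curvature of its Levi-Civita connection vanishes), geodesically complete, and homogeneous (its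 isometry group acts transitively on $M$). In particular, there exists a flat complete homogeneous pseudo-Riemannian manifold of signature $(7,7)$ with non-abelian linear holonomy group. -/

import Mathlib

open scoped Manifold ContDiff Matrix Bundle

noncomputable section

/-! ### Signature of a symmetric bilinear form -/

/-- The form `b` on the real vector space `W` has signature `(p, q)`: there is a basis that is
orthogonal for `b`, with `p` vectors of square `1` and `q` vectors of square `-1`. -/
def HasSignature {W : Type*} [AddCommGroup W] [Module ℝ W] (b : W → W → ℝ) (p q : ℕ) : Prop :=
  ∃ e : Module.Basis (Fin p ⊕ Fin q) ℝ W,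
    ∀ i j, b (e i) (e j) = if i = j then Sum.elim (fun _ => 1) (fun _ => -1) i else 0

/-! ### Pseudo-Riemannian manifolds -/

/-- A smooth pseudo-Riemannian metric on a smooth manifold `M` modelled on `E`. -/
structure PseudoRiemannianMetric (E : Type*) [NormedAddCommGroup E] [NormedSpace ℝ E]
    (M : Type*) [TopologicalSpace M] [ChartedSpace E M] [IsManifold 𝓘(ℝ, E) ∞ M] where
  val (x : M) : TangentSpace 𝓘(ℝ, E) x →L[ℝ] TangentSpace 𝓘(ℝ, E) x →L[ℝ] ℝ
  symm (x : M) (u v : TangentSpace 𝓘(ℝ, E) x) : val x u v = val x v u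
  nondegenerate (x : M) (u : TangentSpace 𝓘(ℝ, E) x) (hu : ∀ v, val x u v = 0) : u = 0
  contMDiff : ContMDiff 𝓘(ℝ, E) (𝓘(ℝ, E).prod 𝓘(ℝ, E →L[ℝ] E →L[ℝ] ℝ)) ∞
    (fun x => Bundle.TotalSpace.mk' (E →L[ℝ] E →L[ℝ] ℝ)
      (E := fun x : M => TangentSpace 𝓘(ℝ, E) x →L[ℝ] TangentSpace 𝓘(ℝ, E) x →L[ℝ] ℝ)
      x (val x))

section Local

variable {E : Type*} [NormedAddCommGroup E] [NormedSpace ℝ E]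

/-- The Christoffel symbols `Γ(y)(u, v)` of the Levi-Civita connection of a metric
`G : E → (E →L[ℝ] E →L[ℝ] ℝ)` given in coordinates:
`2 G(Γ(u, v), w) = (D_u G)(v, w) + (D_v G)(u, w) - (D_w G)(u, v)` for all `w`. The musical
isomorphism is inverted by `ContinuousLinearMap.inverse`, which is the true inverse in finite
dimension since `G y` is nondegenerate. -/
def christoffel (G : E → E →L[ℝ] E →L[ℝ] ℝ) (y u v : E) : E :=
  (1 / 2 : ℝ) • (G y).inverse
    (fderiv ℝ G y u v + fderiv ℝ G y v u - ((fderiv ℝ G y).flip u).flip v)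

/-- The Riemann curvature tensor `R(u, v) w` in coordinates, at the point `y`:
`D_u Γ(v, w) - D_v Γ(u, w) + Γ(u, Γ(v, w)) - Γ(v, Γ(u, w))`. -/
def riemannCurvature (G : E → E →L[ℝ] E →L[ℝ] ℝ) (y u v w : E) : E :=
  fderiv ℝ (fun z => christoffel G z v w) y u - fderiv ℝ (fun z => christoffel G z u w) y v
    + christoffel G y u (christoffel G y v w) - christoffel G y v (christoffel G y u w)

end Local

namespace PseudoRiemannianMetric

variable {E : Type*} [NormedAddCommGroup E] [NormedSpace ℝ E]
  {M : Type*} [TopologicalSpace M] [ChartedSpace E M] [IsManifold 𝓘(ℝ, E) ∞ M]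

/-- The coefficients of the metric in a chart `e`. They are meaningful on `e.target`. -/
def inChart (g : PseudoRiemannianMetric E M) (e : OpenPartialHomeomorph M E) (y : E) :
    E →L[ℝ] E →L[ℝ] ℝ :=
  let G : E →L[ℝ] E →L[ℝ] ℝ := g.val (e.symm y)
  let D : E →L[ℝ] E := mfderiv 𝓘(ℝ, E) 𝓘(ℝ, E) e.symm y
  G.bilinearComp D D

/-- Every tangent space has signature `(p, q)`. -/
def HasConstSignature (g : PseudoRiemannianMetric E M) (p q : ℕ) : Prop :=
  ∀ x : M, HasSignature (fun u v => g.val x u v) p q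

/-- The Levi-Civita connection of the metric has vanishing curvature. -/
def IsFlat (g : PseudoRiemannianMetric E M) : Prop :=
  ∀ e ∈ atlas E M, ∀ y ∈ e.target, ∀ u v w : E, riemannCurvature (g.inChart e) y u v w = 0

/-- `c : ℝ → M` is a (smooth, affinely parametrized) geodesic defined on all of `ℝ`. -/
def IsGeodesic (g : PseudoRiemannianMetric E M) (c : ℝ → M) : Prop :=
  ContMDiff 𝓘(ℝ, ℝ) 𝓘(ℝ, E) ∞ c ∧
  ∀ e ∈ atlas E M, ∀ t : ℝ, c t ∈ e.source →
    deriv (deriv (e ∘ c)) t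
      + christoffel (g.inChart e) (e (c t)) (deriv (e ∘ c) t) (deriv (e ∘ c) t) = 0

/-- Geodesic completeness: every tangent vector is the initial velocity of a geodesic defined on
all of `ℝ`. -/
def IsComplete (g : PseudoRiemannianMetric E M) : Prop :=
  ∀ ξ : TangentBundle 𝓘(ℝ, E) M, ∃ c : ℝ → M, g.IsGeodesic c ∧
    (⟨c 0, mfderiv 𝓘(ℝ, ℝ) 𝓘(ℝ, E) c 0 (1 : ℝ)⟩ : TangentBundle 𝓘(ℝ, E) M) = ξ

/-- The diffeomorphism `f` of `M` is an isometry. -/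
def IsIsometry (g : PseudoRiemannianMetric E M) (f : M ≃ₘ^∞⟮𝓘(ℝ, E), 𝓘(ℝ, E)⟯ M) : Prop :=
  ∀ (x : M) (u v : TangentSpace 𝓘(ℝ, E) x),
    g.val (f x) (mfderiv 𝓘(ℝ, E) 𝓘(ℝ, E) f x u) (mfderiv 𝓘(ℝ, E) 𝓘(ℝ, E) f x v) = g.val x u v

/-- The isometry group acts transitively. -/
def IsHomogeneous (g : PseudoRiemannianMetric E M) : Prop :=
  ∀ x y : M, ∃ f : M ≃ₘ^∞⟮𝓘(ℝ, E), 𝓘(ℝ, E)⟯ M, g.IsIsometry f ∧ f x = y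

end PseudoRiemannianMetric

/-! ### The space `ℝ^{7,7}` and its group of isometries -/

/-- `ℝ¹⁴`, its vectors `(x, y, z)` being written in blocks of sizes `5, 4, 5`. -/
abbrev R77 : Type := (Fin 5 → ℝ) × (Fin 4 → ℝ) × (Fin 5 → ℝ)

/-- The signature matrix `diag(1, 1, -1, -1)`. -/
def Itilde : Matrix (Fin 4) (Fin 4) ℝ := Matrix.diagonal ![1, 1, -1, -1]

/-- The scalar product with matrix `(0, 0, I₅; 0, Ĩ, 0; I₅, 0, 0)`. -/
def form77 (p q : R77) : ℝ :=
  p.1 ⬝ᵥ q.2.2 + p.2.1 ⬝ᵥ (Itilde *ᵥ q.2.1) + p.2.2 ⬝ᵥ q.1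

/-- The isometry group of `ℝ^{7,7}`: affine transformations whose linear part preserves the
scalar product. -/
def Iso77 : Subgroup (R77 ≃ᵃ[ℝ] R77) where
  carrier := {f | ∀ p q, form77 (f.linear p) (f.linear q) = form77 p q}
  mul_mem' := by
    intro f g hf hg p q
    change form77 (f.linear (g.linear p)) (f.linear (g.linear q)) = _
    rw [hf, hg]
  one_mem' := fun _ _ => rfl
  inv_mem' := by
    intro f hf p q
    have h := hf (f.linear.symm p) (f.linear.symm q)
    simp only [LinearEquiv.apply_symm_apply] at h
    exact h.symm

/-- Affine transformations act on `ℝ^{7,7}` by evaluation. -/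
instance affineAction77 : MulAction (R77 ≃ᵃ[ℝ] R77) R77 where
  smul f p := f p
  one_smul _ := rfl
  mul_smul _ _ _ := rfl

/-- The linear automorphism of `ℝ¹⁴` with block matrix `(I₅, -Bᵀ Ĩ, C; 0, I₄, B; 0, 0, I₅)`. -/
def unipotent (B : Matrix (Fin 4) (Fin 5) ℝ) (C : Matrix (Fin 5) (Fin 5) ℝ) : R77 ≃ₗ[ℝ] R77 where
  toFun p := (p.1 + (-(Bᵀ * Itilde)) *ᵥ p.2.1 + C *ᵥ p.2.2, p.2.1 + B *ᵥ p.2.2, p.2.2)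
  invFun p := (p.1 + (Bᵀ * Itilde) *ᵥ (p.2.1 - B *ᵥ p.2.2) - C *ᵥ p.2.2,
    p.2.1 - B *ᵥ p.2.2, p.2.2)
  map_add' p q := by
    simp only [Prod.fst_add, Prod.snd_add, Matrix.mulVec_add, Prod.mk_add_mk, Prod.mk.injEq]
    exact ⟨by abel, by abel, trivial⟩
  map_smul' a p := by
    simp only [Prod.smul_fst, Prod.smul_snd, Matrix.mulVec_smul, RingHom.id_apply, Prod.smul_mk,
      smul_add]
  left_inv p := by
    ext i <;> simp [Matrix.neg_mulVec]
    ring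
  right_inv p := by
    ext i <;> simp [Matrix.neg_mulVec]
    ring

/-- The affine transformation `p ↦ L p + v`. -/
def affineOf (L : R77 ≃ₗ[ℝ] R77) (v : R77) : R77 ≃ᵃ[ℝ] R77 :=
  L.toAffineEquiv.trans (AffineEquiv.constVAdd ℝ R77 v)

theorem affineOf_apply (L : R77 ≃ₗ[ℝ] R77) (v p : R77) : affineOf L v p = L p + v := by
  simp [affineOf, add_comm]

/-! ### The group `Γ_{7,7}` -/

def B₁ : Matrix (Fin 4) (Fin 5) ℝ :=
  !![-1, 0, 0, 0, 0;
     0, -1, 0, 0, 0;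
     0, -1, 0, 0, 0;
     -1, 0, 0, 0, 0]

def C₁ : Matrix (Fin 5) (Fin 5) ℝ :=
  !![0, 0, 0, 0, 0;
     0, 0, 0, 0, 0;
     0, 0, 0, 0, -1;
     0, 0, 0, 0, 0;
     0, 0, 1, 0, 0]

def B₂ : Matrix (Fin 4) (Fin 5) ℝ :=
  !![0, -1, 0, 0, 0;
     1, 0, 0, 0, 0;
     -1, 0, 0, 0, 0;
     0, 1, 0, 0, 0]

def C₂ : Matrix (Fin 5) (Fin 5) ℝ :=
  !![0, 0, 0, 0, 0;
     0, 0, 0, 0, 0;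
     0, 0, 0, 0, 0;
     0, 0, 0, 0, -1;
     0, 0, 0, 1, 0]

def γ₁ : R77 ≃ᵃ[ℝ] R77 := affineOf (unipotent B₁ C₁) (0, 0, ![0, 0, 0, -1, 0])

def γ₂ : R77 ≃ᵃ[ℝ] R77 := affineOf (unipotent B₂ C₂) (0, 0, ![0, 0, 1, 0, 0])

/-- The group generated by `γ₁` and `γ₂`. -/
def Γ77 : Subgroup (R77 ≃ᵃ[ℝ] R77) := Subgroup.closure {γ₁, γ₂}

/-- The linear holonomy group: the group of linear parts of the elements of `Γ`. -/
def linearHolonomy (Γ : Subgroup (R77 ≃ᵃ[ℝ] R77)) : Subgroup (R77 ≃ₗ[ℝ] R77) :=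
  Γ.map AffineEquiv.linearHom

/-- The discrete Heisenberg group of integral unipotent upper triangular `3 × 3` matrices. -/
def heisenbergGroup : Subgroup (Matrix.SpecialLinearGroup (Fin 3) ℤ) where
  carrier := {A | (∀ i, A.1 i i = 1) ∧ ∀ i j, j < i → A.1 i j = 0}
  mul_mem' := by
    rintro A B ⟨hA, hA'⟩ ⟨hB, hB'⟩
    refine ⟨fun i => ?_, fun i j hij => ?_⟩
    · fin_cases i <;> simp [Matrix.mul_apply, Fin.sum_univ_three, hA, hA', hB, hB']
    · fin_cases i <;> fin_cases j <;>
        first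
        | exact absurd hij (by decide)
        | simp [Matrix.mul_apply, Fin.sum_univ_three, hA, hA', hB, hB']
  one_mem' := by
    refine ⟨fun i => by simp, fun i j hij => ?_⟩
    simp [hij.ne']
  inv_mem' := by
    rintro A ⟨hA, hA'⟩
    refine ⟨fun i => ?_, fun i j hij => ?_⟩
    · fin_cases i <;> simp [Matrix.adjugate_fin_three, hA, hA']
    · fin_cases i <;> fin_cases j <;>
        first
        | exact absurd hij (by decide)
        | simp [Matrix.adjugate_fin_three, hA, hA']

/-- The quotient space `M = ℝ^{7,7} / Γ_{7,7}`, with the quotient topology. -/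
abbrev M77 : Type := MulAction.orbitRel.Quotient Γ77 R77

/-- The projection `ℝ^{7,7} → M`. -/
def proj77 (p : R77) : M77 := Quotient.mk _ p

end

noncomputable section


/-! ### The form `form77` -/

/-! The images of `B₁` and `B₂` in ℝ⁴ are totally isotropic for Ĩ but pair nontrivially: B₁ᵀĨB₂ is a
nonzero skew matrix. Hence the linear parts of γ₁ and γ₂ do not commute, and their commutator is a
nontrivial central element. Every element of Γ has a normal form `heisAffine a b c`, whose product
law (`heisAffine_mul`) is that of the integral Heisenberg matrices.

Write points as (x, y, z). The normal form shifts z₂ by a and z₃ by -b; for a = b = 0 it shifts x₄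
by 2c. So any one value of an element of Γ at a known point determines (a, b, c) (`heisAffine_inj`),
which gives freeness, and bounds on these coordinates bound (a, b, c) (`heisAffine_params_le`),
which gives proper discontinuity.

The centralizer contains explicit maps p ↦ p + Xp + v with X skew and X² = 0; three families of them
carry any point to 0 (`exists_mem_centralIso_apply_eq_zero`).

Consequently ℝ^{7,7} → M is a covering. Charts of M are the local inverses of the projection, and
the transition maps are locally elements of Γ, hence affine isometries
(`exists_eventually_chart_proj77`). The scalar product descends to a metric with constant
coefficients in every chart: Christoffel symbols and curvature vanish, images of lines are complete
geodesics, and the centralizer descends to a transitive group of isometries. -/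

theorem form77_apply (p q : R77) :
    form77 p q = p.1 0 * q.2.2 0 + p.1 1 * q.2.2 1 + p.1 2 * q.2.2 2 + p.1 3 * q.2.2 3
      + p.1 4 * q.2.2 4
      + (p.2.1 0 * q.2.1 0 + p.2.1 1 * q.2.1 1 - p.2.1 2 * q.2.1 2 - p.2.1 3 * q.2.1 3)
      + (p.2.2 0 * q.1 0 + p.2.2 1 * q.1 1 + p.2.2 2 * q.1 2 + p.2.2 3 * q.1 3
        + p.2.2 4 * q.1 4) := by
  simp [form77, Itilde, Matrix.mulVec_diagonal, dotProduct, Fin.sum_univ_four, Fin.sum_univ_five]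
  ring

/-- Reduces an identity between vectors or affine maps to fourteen polynomial identities over ℝ. -/
theorem R77.ext_coord {p q : R77} (h₀ : p.1 0 = q.1 0) (h₁ : p.1 1 = q.1 1) (h₂ : p.1 2 = q.1 2)
    (h₃ : p.1 3 = q.1 3) (h₄ : p.1 4 = q.1 4) (k₀ : p.2.1 0 = q.2.1 0) (k₁ : p.2.1 1 = q.2.1 1)
    (k₂ : p.2.1 2 = q.2.1 2) (k₃ : p.2.1 3 = q.2.1 3) (l₀ : p.2.2 0 = q.2.2 0)
    (l₁ : p.2.2 1 = q.2.2 1) (l₂ : p.2.2 2 = q.2.2 2) (l₃ : p.2.2 3 = q.2.2 3)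
    (l₄ : p.2.2 4 = q.2.2 4) : p = q := by
  refine Prod.ext (funext fun i => ?_) (Prod.ext (funext fun i => ?_) (funext fun i => ?_)) <;>
    fin_cases i <;> assumption

theorem form77_comm (p q : R77) : form77 p q = form77 q p := by
  rw [form77_apply, form77_apply]; ring

theorem form77_add_right (p q r : R77) : form77 p (q + r) = form77 p q + form77 p r := by
  simp only [form77_apply, Prod.fst_add, Prod.snd_add, Pi.add_apply]; ring

theorem form77_smul_right (a : ℝ) (p q : R77) : form77 p (a • q) = a * form77 p q := by
  simp only [form77_apply, Prod.smul_fst, Prod.smul_snd, Pi.smul_apply, smul_eq_mul]; ring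

/-- `form77` as a bilinear map. -/
def form77Bilin : R77 →ₗ[ℝ] R77 →ₗ[ℝ] ℝ :=
  LinearMap.mk₂ ℝ form77
    (fun p q r => by rw [form77_comm, form77_add_right, form77_comm r, form77_comm r])
    (fun a p q => by rw [form77_comm, form77_smul_right, form77_comm q, smul_eq_mul])
    form77_add_right (fun a p q => form77_smul_right a p q)

@[simp] theorem form77Bilin_apply (p q : R77) : form77Bilin p q = form77 p q := rfl

theorem form77_nondegenerate (p : R77) (h : ∀ q, form77 p q = 0) : p = 0 := by
  have hx : ∀ i, p.1 i = 0 := fun i => by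
    have := h (0, 0, Pi.single i 1)
    simpa [form77] using this
  have hz : ∀ i, p.2.2 i = 0 := fun i => by
    have := h (Pi.single i 1, 0, 0)
    simpa [form77] using this
  have hy : ∀ i, p.2.1 i = 0 := fun i => by
    have := h (0, Pi.single i 1, 0)
    rw [form77_apply] at this
    fin_cases i <;> simpa using this
  exact Prod.ext (funext hx) (Prod.ext (funext hy) (funext hz))

/-- A family of vectors that is orthogonal for a bilinear form and has no isotropic member is
linearly independent. -/
theorem LinearMap.linearIndependent_of_orthogonal {ι V : Type*} [AddCommGroup V] [Module ℝ V]
    (b : V →ₗ[ℝ] V →ₗ[ℝ] ℝ) (v : ι → V) (h : ∀ i j, i ≠ j → b (v i) (v j) = 0)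
    (h' : ∀ i, b (v i) (v i) ≠ 0) : LinearIndependent ℝ v :=
  LinearMap.linearIndependent_of_isOrthoᵢ (B := b) (fun i j hij => h i j hij) h'

/-- An orthogonal basis of `ℝ^{7,7}` made of vectors of square `±1`. -/
def orthoVec : Fin 7 ⊕ Fin 7 → R77 :=
  Sum.elim
    ![(![1, 0, 0, 0, 0], 0, ![1 / 2, 0, 0, 0, 0]),
      (![0, 1, 0, 0, 0], 0, ![0, 1 / 2, 0, 0, 0]),
      (![0, 0, 1, 0, 0], 0, ![0, 0, 1 / 2, 0, 0]),
      (![0, 0, 0, 1, 0], 0, ![0, 0, 0, 1 / 2, 0]),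
      (![0, 0, 0, 0, 1], 0, ![0, 0, 0, 0, 1 / 2]),
      (0, ![1, 0, 0, 0], 0),
      (0, ![0, 1, 0, 0], 0)]
    ![(![1, 0, 0, 0, 0], 0, ![-1 / 2, 0, 0, 0, 0]),
      (![0, 1, 0, 0, 0], 0, ![0, -1 / 2, 0, 0, 0]),
      (![0, 0, 1, 0, 0], 0, ![0, 0, -1 / 2, 0, 0]),
      (![0, 0, 0, 1, 0], 0, ![0, 0, 0, -1 / 2, 0]),
      (![0, 0, 0, 0, 1], 0, ![0, 0, 0, 0, -1 / 2]),
      (0, ![0, 0, 1, 0], 0),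
      (0, ![0, 0, 0, 1], 0)]

-- If e and f are isotropic with ⟨e, f⟩ = 1, then e ± f/2 has square ±1. The x and z blocks supply
-- five such pairs; the y block is already diagonal.
set_option maxHeartbeats 1000000 in
theorem form77_orthoVec (i j : Fin 7 ⊕ Fin 7) :
    form77 (orthoVec i) (orthoVec j)
      = if i = j then Sum.elim (fun _ => 1) (fun _ => -1) i else 0 := by
  rw [form77_apply]
  rcases i with i | i <;> rcases j with j | j <;> fin_cases i <;> fin_cases j <;>
    simp [orthoVec] <;> norm_num

theorem hasSignature_form77 : HasSignature form77 7 7 := by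
  have hli : LinearIndependent ℝ orthoVec := by
    refine LinearMap.linearIndependent_of_orthogonal form77Bilin _ (fun i j hij => ?_)
      fun i => ?_
    · rw [form77Bilin_apply, form77_orthoVec, if_neg hij]
    · rw [form77Bilin_apply, form77_orthoVec, if_pos rfl]
      rcases i with i | i <;> norm_num
  refine ⟨basisOfLinearIndependentOfCardEqFinrank hli (by simp), fun i j => ?_⟩
  rw [coe_basisOfLinearIndependentOfCardEqFinrank, form77_orthoVec]

/-! ### Explicit description of `Γ77` -/

theorem unipotent_apply (B : Matrix (Fin 4) (Fin 5) ℝ) (C : Matrix (Fin 5) (Fin 5) ℝ) (p : R77) :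
    unipotent B C p =
      (fun i => p.1 i - (B 0 i * p.2.1 0 + B 1 i * p.2.1 1 - B 2 i * p.2.1 2 - B 3 i * p.2.1 3)
          + (C i 0 * p.2.2 0 + C i 1 * p.2.2 1 + C i 2 * p.2.2 2 + C i 3 * p.2.2 3
            + C i 4 * p.2.2 4),
        fun i => p.2.1 i + (B i 0 * p.2.2 0 + B i 1 * p.2.2 1 + B i 2 * p.2.2 2 + B i 3 * p.2.2 3
            + B i 4 * p.2.2 4),
        p.2.2) := by
  refine Prod.ext (funext fun i => ?_) (Prod.ext (funext fun i => ?_) rfl)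
  · change p.1 i + ((-(Bᵀ * Itilde)) *ᵥ p.2.1) i + (C *ᵥ p.2.2) i = _
    simp [Itilde, Matrix.mulVec, dotProduct, Fin.sum_univ_four, Fin.sum_univ_five]
    ring
  · change p.2.1 i + (B *ᵥ p.2.2) i = _
    simp [Matrix.mulVec, dotProduct, Fin.sum_univ_five]

/-- The element `γ₂ ^ a * γ₁ ^ b * [γ₁, γ₂] ^ c` of `Γ77`. -/
def heisAffine (a b c : ℤ) : R77 ≃ᵃ[ℝ] R77 :=
  affineOf
    (unipotent ((a : ℝ) • B₂ + (b : ℝ) • B₁)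
      !![0, 2 * a * b - 4 * c, 0, 0, 0;
         -(2 * a * b - 4 * c), 0, 0, 0, 0;
         0, 0, 0, 0, -b;
         0, 0, 0, 0, -a;
         0, 0, b, a, 0])
    (![0, 0, 0, 0, 2 * c - a * b], 0, ![0, 0, a, -b, 0])

theorem heisAffine_linear_apply (a b c : ℤ) (p : R77) :
    (heisAffine a b c).linear p =
      (![p.1 0 + b * p.2.1 0 - a * p.2.1 1 - a * p.2.1 2 - b * p.2.1 3
          + (2 * a * b - 4 * c) * p.2.2 1,
        p.1 1 + a * p.2.1 0 + b * p.2.1 1 - b * p.2.1 2 + a * p.2.1 3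
          - (2 * a * b - 4 * c) * p.2.2 0,
        p.1 2 - b * p.2.2 4, p.1 3 - a * p.2.2 4,
        p.1 4 + b * p.2.2 2 + a * p.2.2 3],
       ![p.2.1 0 - b * p.2.2 0 - a * p.2.2 1, p.2.1 1 + a * p.2.2 0 - b * p.2.2 1,
        p.2.1 2 - a * p.2.2 0 - b * p.2.2 1, p.2.1 3 - b * p.2.2 0 + a * p.2.2 1],
       p.2.2) := by
  change unipotent _ _ p = _
  rw [unipotent_apply]
  apply R77.ext_coord <;> simp [B₁, B₂] <;> ring

theorem heisAffine_apply (a b c : ℤ) (p : R77) :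
    heisAffine a b c p =
      (![p.1 0 + b * p.2.1 0 - a * p.2.1 1 - a * p.2.1 2 - b * p.2.1 3
          + (2 * a * b - 4 * c) * p.2.2 1,
        p.1 1 + a * p.2.1 0 + b * p.2.1 1 - b * p.2.1 2 + a * p.2.1 3
          - (2 * a * b - 4 * c) * p.2.2 0,
        p.1 2 - b * p.2.2 4, p.1 3 - a * p.2.2 4,
        p.1 4 + b * p.2.2 2 + a * p.2.2 3 + 2 * c - a * b],
       ![p.2.1 0 - b * p.2.2 0 - a * p.2.2 1, p.2.1 1 + a * p.2.2 0 - b * p.2.2 1,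
        p.2.1 2 - a * p.2.2 0 - b * p.2.2 1, p.2.1 3 - b * p.2.2 0 + a * p.2.2 1],
       ![p.2.2 0, p.2.2 1, p.2.2 2 + a, p.2.2 3 - b, p.2.2 4]) := by
  have h : heisAffine a b c p = (heisAffine a b c).linear p
      + (![0, 0, 0, 0, 2 * (c : ℝ) - a * b], 0, ![0, 0, (a : ℝ), -b, 0]) := affineOf_apply _ _ _
  rw [h, heisAffine_linear_apply]
  apply R77.ext_coord <;> simp only [Prod.fst_add, Prod.snd_add, Pi.add_apply] <;> simp <;> ring

theorem heisAffine_mem_Iso77 (a b c : ℤ) : heisAffine a b c ∈ Iso77 := by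
  intro p q
  simp only [heisAffine_linear_apply, form77_apply]
  simp
  ring

/-- The coefficients 2ab - 4c and 2c - ab in `heisAffine` are the ones for which the only correction
is the Heisenberg term b a'. It comes from the products of `B₁` with `B₂` in the linear part and
from the `C` blocks acting on the shifts of z₂ and z₃ in the translation part. -/
theorem heisAffine_mul (a b c a' b' c' : ℤ) :
    heisAffine a b c * heisAffine a' b' c' =
      heisAffine (a + a') (b + b') (c + c' + b * a') := by
  ext1 p
  rw [AffineEquiv.mul_def, AffineEquiv.trans_apply]
  simp only [heisAffine_apply]
  apply R77.ext_coord <;> simp <;> ring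

theorem heisAffine_zero : heisAffine 0 0 0 = 1 := by
  ext1 p
  rw [heisAffine_apply]
  apply R77.ext_coord <;> simp

/-- The coordinates z₂ and z₃ of the image reveal a and b; once these agree, x₄ reveals c. -/
theorem heisAffine_inj {a b c a' b' c' : ℤ} {p : R77}
    (h : heisAffine a b c p = heisAffine a' b' c' p) : a = a' ∧ b = b' ∧ c = c' := by
  rw [heisAffine_apply, heisAffine_apply] at h
  have h₂ := congrFun (congrArg (fun q : R77 => q.2.2) h) 2
  have h₃ := congrFun (congrArg (fun q : R77 => q.2.2) h) 3
  have h₄ := congrFun (congrArg (fun q : R77 => q.1) h) 4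
  simp at h₂ h₃ h₄
  subst h₂ h₃
  exact ⟨rfl, rfl, by simpa using h₄⟩

theorem γ₁_eq : γ₁ = heisAffine 0 1 0 := by
  ext1 p
  rw [heisAffine_apply, γ₁, affineOf_apply, unipotent_apply]
  apply R77.ext_coord <;> simp only [Prod.fst_add, Prod.snd_add, Pi.add_apply] <;>
    simp [B₁, C₁] <;> ring

theorem γ₂_eq : γ₂ = heisAffine 1 0 0 := by
  ext1 p
  rw [heisAffine_apply, γ₂, affineOf_apply, unipotent_apply]
  apply R77.ext_coord <;> simp only [Prod.fst_add, Prod.snd_add, Pi.add_apply] <;>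
    simp [B₂, C₂] <;> ring

/-! ### Isomorphism with the discrete Heisenberg group, freeness and holonomy -/

theorem heisenberg_entries (A : heisenbergGroup) :
    A.1.1 0 0 = 1 ∧ A.1.1 1 1 = 1 ∧ A.1.1 2 2 = 1 ∧ A.1.1 1 0 = 0 ∧ A.1.1 2 0 = 0
      ∧ A.1.1 2 1 = 0 :=
  ⟨A.2.1 0, A.2.1 1, A.2.1 2, A.2.2 1 0 (by decide), A.2.2 2 0 (by decide), A.2.2 2 1 (by decide)⟩

/-- The action of the discrete Heisenberg group on `ℝ^{7,7}`. -/
def heisHom : heisenbergGroup →* (R77 ≃ᵃ[ℝ] R77) where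
  toFun A := heisAffine (A.1.1 1 2) (A.1.1 0 1) (A.1.1 0 2)
  map_one' := by
    rw [← heisAffine_zero]
    rfl
  map_mul' A B := by
    obtain ⟨hA₀, hA₁, hA₂, hA₃, hA₄, hA₅⟩ := heisenberg_entries A
    obtain ⟨hB₀, hB₁, hB₂, hB₃, hB₄, hB₅⟩ := heisenberg_entries B
    rw [heisAffine_mul]
    congr 1 <;>
      simp [Matrix.mul_apply, Fin.sum_univ_three, hA₀, hA₁, hA₃, hB₁, hB₂, hB₅] <;> ring

theorem heisHom_injective : Function.Injective heisHom := by
  intro A B h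
  obtain ⟨hA₀, hA₁, hA₂, hA₃, hA₄, hA₅⟩ := heisenberg_entries A
  obtain ⟨hB₀, hB₁, hB₂, hB₃, hB₄, hB₅⟩ := heisenberg_entries B
  obtain ⟨h₁, h₂, h₃⟩ := heisAffine_inj (congrArg (fun f : R77 ≃ᵃ[ℝ] R77 => f 0) h)
  refine Subtype.ext (Subtype.ext (Matrix.ext fun i j => ?_))
  fin_cases i <;> fin_cases j <;> simp_all

/-- The element of the Heisenberg group with given entries above the diagonal. -/
def heisElement (a b c : ℤ) : heisenbergGroup :=
  ⟨⟨!![1, b, c; 0, 1, a; 0, 0, 1], by simp [Matrix.det_fin_three]⟩,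
    fun i => by fin_cases i <;> rfl,
    fun i j hij => by
      fin_cases i <;> fin_cases j <;> first | rfl | exact absurd hij (by decide)⟩

theorem heisHom_heisElement (a b c : ℤ) : heisHom (heisElement a b c) = heisAffine a b c := rfl

theorem heisAffine_zpow_left (a : ℤ) : heisAffine 1 0 0 ^ a = heisAffine a 0 0 := by
  induction a using Int.induction_on with
  | zero => rw [zpow_zero, heisAffine_zero]
  | succ n ih => rw [zpow_add_one, ih, heisAffine_mul]; simp
  | pred n ih =>
    rw [zpow_sub_one, ih, mul_inv_eq_iff_eq_mul, heisAffine_mul]; simp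

theorem heisAffine_zpow_mid (b : ℤ) : heisAffine 0 1 0 ^ b = heisAffine 0 b 0 := by
  induction b using Int.induction_on with
  | zero => rw [zpow_zero, heisAffine_zero]
  | succ n ih => rw [zpow_add_one, ih, heisAffine_mul]; simp
  | pred n ih =>
    rw [zpow_sub_one, ih, mul_inv_eq_iff_eq_mul, heisAffine_mul]; simp

theorem heisAffine_zpow_right (c : ℤ) : heisAffine 0 0 1 ^ c = heisAffine 0 0 c := by
  induction c using Int.induction_on with
  | zero => rw [zpow_zero, heisAffine_zero]
  | succ n ih => rw [zpow_add_one, ih, heisAffine_mul]; simp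
  | pred n ih =>
    rw [zpow_sub_one, ih, mul_inv_eq_iff_eq_mul, heisAffine_mul]; simp

theorem heisHom_range : heisHom.range = Γ77 := by
  apply le_antisymm
  · rintro _ ⟨A, rfl⟩
    have h₁ : heisAffine 0 1 0 ∈ Γ77 := γ₁_eq ▸ Subgroup.subset_closure (by simp)
    have h₂ : heisAffine 1 0 0 ∈ Γ77 := γ₂_eq ▸ Subgroup.subset_closure (by simp)
    have h₃ : heisAffine 0 0 1 ∈ Γ77 := by
      -- The central generator is the commutator γ₁⁻¹γ₂⁻¹γ₁γ₂.
      have h : heisAffine 0 0 1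
          = (heisAffine 1 0 0 * heisAffine 0 1 0)⁻¹ * (heisAffine 0 1 0 * heisAffine 1 0 0) := by
        rw [eq_inv_mul_iff_mul_eq]
        simp [heisAffine_mul]
      rw [h]
      exact mul_mem (inv_mem (mul_mem h₂ h₁)) (mul_mem h₁ h₂)
    have h : ∀ a b c : ℤ, heisAffine a b c
        = heisAffine 1 0 0 ^ a * heisAffine 0 1 0 ^ b * heisAffine 0 0 1 ^ c := by
      intro a b c
      rw [heisAffine_zpow_left, heisAffine_zpow_mid, heisAffine_zpow_right]
      simp [heisAffine_mul]
    change heisAffine _ _ _ ∈ Γ77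
    rw [h]
    exact mul_mem (mul_mem (zpow_mem h₂ _) (zpow_mem h₁ _)) (zpow_mem h₃ _)
  · rw [Γ77, Subgroup.closure_le]
    rintro _ (rfl | rfl)
    · exact ⟨heisElement 0 1 0, by rw [heisHom_heisElement, γ₁_eq]⟩
    · exact ⟨heisElement 1 0 0, by rw [heisHom_heisElement, γ₂_eq]⟩

theorem exists_eq_heisAffine {γ : R77 ≃ᵃ[ℝ] R77} (h : γ ∈ Γ77) :
    ∃ a b c, γ = heisAffine a b c := by
  rw [← heisHom_range] at h
  obtain ⟨A, rfl⟩ := h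
  exact ⟨_, _, _, rfl⟩

theorem heisAffine_mem_Γ77 (a b c : ℤ) : heisAffine a b c ∈ Γ77 := by
  rw [← heisHom_range, ← heisHom_heisElement]
  exact ⟨_, rfl⟩

/-- `Γ77` is isomorphic to the discrete Heisenberg group. -/
def Γ77EquivHeisenberg : Γ77 ≃* heisenbergGroup :=
  (MulEquiv.subgroupCongr heisHom_range.symm).trans
    (MonoidHom.ofInjective heisHom_injective).symm

theorem Γ77_le_Iso77 : Γ77 ≤ Iso77 := by
  intro γ h
  obtain ⟨a, b, c, rfl⟩ := exists_eq_heisAffine h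
  exact heisAffine_mem_Iso77 a b c

theorem Γ77_free {γ : R77 ≃ᵃ[ℝ] R77} (h : γ ∈ Γ77) {p : R77} (hp : γ p = p) : γ = 1 := by
  obtain ⟨a, b, c, rfl⟩ := exists_eq_heisAffine h
  have h1 : heisAffine 0 0 0 p = p := by rw [heisAffine_zero]; rfl
  obtain ⟨rfl, rfl, rfl⟩ := heisAffine_inj (hp.trans h1.symm)
  exact heisAffine_zero

theorem linearHolonomy_not_comm :
    ¬ ∀ a ∈ linearHolonomy Γ77, ∀ b ∈ linearHolonomy Γ77, a * b = b * a := by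
  intro h
  have h₁ := h _ (Subgroup.mem_map_of_mem AffineEquiv.linearHom (heisAffine_mem_Γ77 0 1 0))
    _ (Subgroup.mem_map_of_mem AffineEquiv.linearHom (heisAffine_mem_Γ77 1 0 0))
  rw [← map_mul, ← map_mul, heisAffine_mul, heisAffine_mul] at h₁
  -- On the unit vector of z₀, the x₁ coordinate of the image is 4c - 2ab: it is 2 for γ₁γ₂ (c = 1)
  -- and -2 for γ₂γ₁ (c = 0).
  have h₂ := LinearEquiv.congr_fun h₁ ((0, 0, Pi.single 0 1) : R77)
  rw [AffineEquiv.linearHom_apply, AffineEquiv.linearHom_apply, heisAffine_linear_apply,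
    heisAffine_linear_apply] at h₂
  have h₃ := congrFun (congrArg Prod.fst h₂) 1
  norm_num at h₃


/-! ### The centralizer of `Γ77` is transitive -/

/-- The linear automorphism `1 + X` for an endomorphism `X` of square zero. -/
def onePlus (X : R77 →ₗ[ℝ] R77) (hX : ∀ p, X (X p) = 0) : R77 ≃ₗ[ℝ] R77 where
  toFun p := p + X p
  invFun p := p - X p
  map_add' p q := by rw [map_add]; abel
  map_smul' a p := by rw [map_smul, RingHom.id_apply, smul_add]
  left_inv p := by simp [hX]
  right_inv p := by simp [hX]

/-- Infinitesimal isometry commuting with `Γ77`, whose translation part is in the coordinates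
`z₀, z₁`. -/
def centralX₁ (s t : ℝ) : R77 →ₗ[ℝ] R77 where
  toFun p :=
    (![-(2 * t * p.1 4), 2 * s * p.1 4, t * p.2.1 0 - s * p.2.1 1 - s * p.2.1 2 + t * p.2.1 3,
        -(s * p.2.1 0) - t * p.2.1 1 + t * p.2.1 2 + s * p.2.1 3, 0],
      ![-(t * p.2.2 2) + s * p.2.2 3, s * p.2.2 2 + t * p.2.2 3, -(s * p.2.2 2) + t * p.2.2 3,
        t * p.2.2 2 + s * p.2.2 3],
      ![0, 0, 0, 0, 2 * t * p.2.2 0 - 2 * s * p.2.2 1])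
  map_add' p q := by apply R77.ext_coord <;> simp <;> ring
  map_smul' a p := by apply R77.ext_coord <;> simp <;> ring

/-- Infinitesimal isometry commuting with `Γ77`, whose translation part is in the coordinates
`z₂, z₃, z₄`. -/
def centralX₂ (a b c : ℝ) : R77 →ₗ[ℝ] R77 where
  toFun p :=
    (![0, 0, c * p.2.2 3 - b * p.2.2 4, -(c * p.2.2 2) + a * p.2.2 4, b * p.2.2 2 - a * p.2.2 3],
      0, 0)
  map_add' p q := by apply R77.ext_coord <;> simp <;> ring
  map_smul' a p := by apply R77.ext_coord <;> simp <;> ring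

/-- Infinitesimal isometry commuting with `Γ77`, whose translation part is in the coordinates
`y` (and `x`). -/
def centralX₃ (s : Fin 4 → ℝ) : R77 →ₗ[ℝ] R77 where
  toFun p :=
    (![-((s 1 + s 2) * p.2.2 2) + (s 3 - s 0) * p.2.2 3,
        (s 0 + s 3) * p.2.2 2 + (s 2 - s 1) * p.2.2 3,
        (s 1 + s 2) * p.2.2 0 - (s 0 + s 3) * p.2.2 1,
        (s 0 - s 3) * p.2.2 0 + (s 1 - s 2) * p.2.2 1, 0], 0, 0)
  map_add' p q := by apply R77.ext_coord <;> simp <;> ring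
  map_smul' a p := by apply R77.ext_coord <;> simp <;> ring

theorem centralX₁_sq (s t : ℝ) (p : R77) : centralX₁ s t (centralX₁ s t p) = 0 := by
  apply R77.ext_coord <;> simp [centralX₁] <;> ring

theorem centralX₂_sq (a b c : ℝ) (p : R77) : centralX₂ a b c (centralX₂ a b c p) = 0 := by
  apply R77.ext_coord <;> simp [centralX₂]

theorem centralX₃_sq (s : Fin 4 → ℝ) (p : R77) : centralX₃ s (centralX₃ s p) = 0 := by
  apply R77.ext_coord <;> simp [centralX₃]

/-- The affine transformation `p ↦ p + X p + v`, where `X` has square zero. -/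
def centralAffine (X : R77 →ₗ[ℝ] R77) (hX : ∀ p, X (X p) = 0) (v : R77) : R77 ≃ᵃ[ℝ] R77 :=
  affineOf (onePlus X hX) v

theorem centralAffine_apply (X : R77 →ₗ[ℝ] R77) (hX : ∀ p, X (X p) = 0) (v p : R77) :
    centralAffine X hX v p = p + X p + v :=
  affineOf_apply _ _ _

/-- The group of isometries of `ℝ^{7,7}` that commute with `Γ77`. -/
def centralIso : Subgroup (R77 ≃ᵃ[ℝ] R77) :=
  Subgroup.centralizer (Γ77 : Set (R77 ≃ᵃ[ℝ] R77)) ⊓ Iso77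

theorem centralAffine_mem {X : R77 →ₗ[ℝ] R77} {hX : ∀ p, X (X p) = 0} {v : R77}
    (hiso : ∀ p q, form77 (p + X p) (q + X q) = form77 p q)
    (hcomm : ∀ (a b c : ℤ) (p : R77), heisAffine a b c (p + X p + v)
      = heisAffine a b c p + X (heisAffine a b c p) + v) :
    centralAffine X hX v ∈ centralIso := by
  refine ⟨Subgroup.mem_centralizer_iff.mpr fun γ hγ => ?_, hiso⟩
  obtain ⟨a, b, c, rfl⟩ := exists_eq_heisAffine hγ
  ext1 p
  rw [AffineEquiv.mul_def, AffineEquiv.mul_def, AffineEquiv.trans_apply, AffineEquiv.trans_apply,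
    centralAffine_apply, centralAffine_apply, hcomm]

theorem centralAffine₁_mem (s t : ℝ) :
    centralAffine (centralX₁ s t) (centralX₁_sq s t) (0, 0, ![s, t, 0, 0, 0]) ∈ centralIso := by
  apply centralAffine_mem
  · intro p q
    simp [form77_apply, centralX₁]
    ring
  · intro a b c p
    simp only [heisAffine_apply]
    apply R77.ext_coord <;> simp only [Prod.fst_add, Prod.snd_add, Pi.add_apply] <;>
      simp [centralX₁] <;> ring

theorem centralAffine₂_mem (a b c : ℝ) :
    centralAffine (centralX₂ a b c) (centralX₂_sq a b c) (0, 0, ![0, 0, a, b, c])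
      ∈ centralIso := by
  apply centralAffine_mem
  · intro p q
    simp [form77_apply, centralX₂]
    ring
  · intro a b c p
    simp only [heisAffine_apply]
    apply R77.ext_coord <;> simp only [Prod.fst_add, Prod.snd_add, Pi.add_apply] <;>
      simp [centralX₂] <;> ring

theorem centralAffine₃_mem (x : Fin 5 → ℝ) (s : Fin 4 → ℝ) :
    centralAffine (centralX₃ s) (centralX₃_sq s) (x, s, 0) ∈ centralIso := by
  apply centralAffine_mem
  · intro p q
    simp [form77_apply, centralX₃]
    ring
  · intro a b c p
    simp only [heisAffine_apply]
    apply R77.ext_coord <;> simp only [Prod.fst_add, Prod.snd_add, Pi.add_apply] <;>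
      simp [centralX₃] <;> ring

/-- The order matters. `f₁` kills z₀ and z₁ and may disturb everything but z₂, z₃; `f₂` kills z₂,
z₃, z₄ and otherwise alters only x; once z = 0, `centralX₃` vanishes at the point, so `f₃` acts on
it as a translation in x and y. -/
theorem exists_mem_centralIso_apply_eq_zero (p : R77) : ∃ f ∈ centralIso, f p = 0 := by
  let f₁ := centralAffine (centralX₁ (-p.2.2 0) (-p.2.2 1)) (centralX₁_sq _ _)
    (0, 0, ![-p.2.2 0, -p.2.2 1, 0, 0, 0])
  let p₁ := f₁ p
  let f₂ := centralAffine (centralX₂ (-p₁.2.2 2) (-p₁.2.2 3) (-p₁.2.2 4)) (centralX₂_sq _ _ _)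
    (0, 0, ![0, 0, -p₁.2.2 2, -p₁.2.2 3, -p₁.2.2 4])
  let p₂ := f₂ p₁
  let f₃ := centralAffine (centralX₃ (-p₂.2.1)) (centralX₃_sq _) (-p₂.1, -p₂.2.1, 0)
  have h₁ : p₁.2.2 0 = 0 ∧ p₁.2.2 1 = 0 := by
    constructor <;>
      simp [p₁, f₁, centralAffine_apply, centralX₁, Matrix.vecHead, Matrix.vecTail]
  have h₂ : p₂.2.2 = 0 := by
    funext i
    fin_cases i <;> simp [p₂, f₂, centralAffine_apply, centralX₂, h₁]
  refine ⟨f₃ * (f₂ * f₁), mul_mem (centralAffine₃_mem _ _)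
    (mul_mem (centralAffine₂_mem _ _ _) (centralAffine₁_mem _ _)), ?_⟩
  change f₃ p₂ = 0
  have h₃ : centralX₃ (-p₂.2.1) p₂ = 0 := by
    apply R77.ext_coord <;> simp [centralX₃, h₂]
  rw [centralAffine_apply, h₃]
  refine Prod.ext ?_ (Prod.ext ?_ ?_) <;> simp [h₂]

theorem centralIso_transitive (p q : R77) : ∃ f ∈ centralIso, f p = q := by
  obtain ⟨f, hf, hfp⟩ := exists_mem_centralIso_apply_eq_zero p
  obtain ⟨g, hg, hgq⟩ := exists_mem_centralIso_apply_eq_zero q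
  refine ⟨g⁻¹ * f, mul_mem (inv_mem hg) hf, ?_⟩
  change g.symm (f p) = q
  rw [hfp, ← hgq, AffineEquiv.symm_apply_apply]

/-! ### Proper discontinuity and the topology of the quotient -/

theorem AffineEquiv.continuous_R77 (f : R77 ≃ᵃ[ℝ] R77) : Continuous f :=
  f.toAffineMap.continuous_of_finiteDimensional

instance : ContinuousConstSMul Γ77 R77 :=
  ⟨fun γ => AffineEquiv.continuous_R77 γ.1⟩

theorem exists_abs_coord_le {K : Set R77} (hK : IsCompact K) :
    ∃ n : ℕ, ∀ p ∈ K, (∀ i, |p.1 i| ≤ n) ∧ ∀ i, |p.2.2 i| ≤ n := by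
  obtain ⟨R, hR⟩ := hK.isBounded.exists_norm_le
  obtain ⟨n, hn⟩ := exists_nat_ge R
  refine ⟨n, fun p hp => ⟨fun i => ?_, fun i => ?_⟩⟩
  · exact (norm_le_pi_norm p.1 i).trans ((norm_fst_le p).trans ((hR p hp).trans hn))
  · exact (norm_le_pi_norm p.2.2 i).trans ((norm_snd_le p.2).trans ((norm_snd_le p).trans
      ((hR p hp).trans hn)))

/-- The displacements of z₂ and z₃ bound a and b. Then x₄ bounds 2c by 2n + 2n² + 2n² + 4n², and the
stated bound on c is twice what this gives. -/
theorem heisAffine_params_le {a b c : ℤ} {p : R77} {n : ℕ}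
    (hp : (∀ i, |p.1 i| ≤ n) ∧ ∀ i, |p.2.2 i| ≤ n)
    (hq : (∀ i, |(heisAffine a b c p).1 i| ≤ n) ∧ ∀ i, |(heisAffine a b c p).2.2 i| ≤ n) :
    |a| ≤ 2 * n ∧ |b| ≤ 2 * n ∧ |c| ≤ 2 * n + 8 * n ^ 2 := by
  rw [heisAffine_apply] at hq
  have p₂ := hp.2 2
  have p₃ := hp.2 3
  have p₄ := hp.1 4
  have q₂ : |p.2.2 2 + a| ≤ n := hq.2 2
  have q₃ : |p.2.2 3 - b| ≤ n := hq.2 3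
  have q₄ : |p.1 4 + b * p.2.2 2 + a * p.2.2 3 + 2 * c - a * b| ≤ n := hq.1 4
  have ha : |(a : ℝ)| ≤ 2 * n := by
    rw [abs_le] at *; constructor <;> linarith
  have hb : |(b : ℝ)| ≤ 2 * n := by
    rw [abs_le] at *; constructor <;> linarith
  have hn : (0 : ℝ) ≤ n := Nat.cast_nonneg n
  have h₁ : |(b : ℝ) * p.2.2 2| ≤ 2 * n * n := by
    rw [abs_mul]; exact mul_le_mul hb p₂ (abs_nonneg _) (by positivity)
  have h₂ : |(a : ℝ) * p.2.2 3| ≤ 2 * n * n := by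
    rw [abs_mul]; exact mul_le_mul ha p₃ (abs_nonneg _) (by positivity)
  have h₃ : |(a : ℝ) * b| ≤ 2 * n * (2 * n) := by
    rw [abs_mul]; exact mul_le_mul ha hb (abs_nonneg _) (by positivity)
  have hc : |(c : ℝ)| ≤ 2 * n + 8 * n ^ 2 := by
    rw [abs_le] at *; constructor <;> nlinarith
  exact ⟨by exact_mod_cast ha, by exact_mod_cast hb, by exact_mod_cast hc⟩

instance : ProperlyDiscontinuousSMul Γ77 R77 := by
  constructor
  intro K L hK hL
  obtain ⟨n, hn⟩ := exists_abs_coord_le (hK.union hL)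
  let P : ℤ × ℤ × ℤ → Γ77 := fun t => ⟨heisAffine t.1 t.2.1 t.2.2, heisAffine_mem_Γ77 _ _ _⟩
  let m : ℤ := 2 * n + 8 * n ^ 2
  refine ((Set.finite_Icc (-(m, m, m)) (m, m, m)).image P).subset ?_
  rintro ⟨γ, hγ⟩ ⟨_, ⟨p, hp, rfl⟩, hq⟩
  obtain ⟨a, b, c, rfl⟩ := exists_eq_heisAffine hγ
  obtain ⟨ha, hb, hc⟩ := heisAffine_params_le (hn p (Or.inl hp)) (hn _ (Or.inr hq))
  have hm : (2 * n : ℤ) ≤ m := by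
    have : (0 : ℤ) ≤ 8 * n ^ 2 := by positivity
    simp only [m]; linarith
  have ha' := abs_le.mp (ha.trans hm)
  have hb' := abs_le.mp (hb.trans hm)
  have hc' := abs_le.mp hc
  exact ⟨(a, b, c), ⟨⟨ha'.1, hb'.1, hc'.1⟩, ⟨ha'.2, hb'.2, hc'.2⟩⟩, rfl⟩

theorem isCancelSMul_Γ77 : IsCancelSMul Γ77 R77 where
  right_cancel' γ δ p h := by
    have h₁ : (δ⁻¹ * γ) • p = p := by rw [mul_smul, h, inv_smul_smul]
    have h₂ : δ⁻¹ * γ = 1 := Subtype.ext (Γ77_free (δ⁻¹ * γ).2 h₁)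
    rw [inv_mul_eq_one] at h₂
    exact h₂.symm

theorem isQuotientCoveringMap_proj77 : IsQuotientCoveringMap proj77 Γ77 :=
  have := isCancelSMul_Γ77
  isQuotientCoveringMap_quotientMk_of_properlyDiscontinuousSMul

theorem isLocalHomeomorph_proj77 : IsLocalHomeomorph proj77 :=
  isQuotientCoveringMap_proj77.isCoveringMap.isLocalHomeomorph

instance : T2Space M77 := t2Space_of_properlyDiscontinuousSMul_of_t2Space

instance : SecondCountableTopology M77 := ContinuousConstSMul.secondCountableTopology

instance : ConnectedSpace M77 := Quotient.instConnectedSpace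

theorem proj77_surjective : Function.Surjective proj77 := Quotient.mk_surjective

theorem proj77_eq_iff {p q : R77} : proj77 p = proj77 q ↔ ∃ γ : Γ77, γ.1 q = p :=
  isQuotientCoveringMap_proj77.apply_eq_iff_mem_orbit


open Topology

/-! ### The smooth structure of the quotient -/

/-- The local inverses of the projection `ℝ^{7,7} → M`. -/
def projCharts : Set (OpenPartialHomeomorph M77 R77) :=
  {e | ∀ y ∈ e.target, e.symm y = proj77 y}

theorem exists_projChart (p : R77) : ∃ e ∈ projCharts, p ∈ e.target := by
  obtain ⟨e, hp, he⟩ := isLocalHomeomorph_proj77 p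
  exact ⟨e.symm, fun y _ => by rw [OpenPartialHomeomorph.symm_symm, he], hp⟩

theorem exists_projChart_source (x : M77) : ∃ e ∈ projCharts, x ∈ e.source := by
  obtain ⟨p, rfl⟩ := proj77_surjective x
  obtain ⟨e, he, hp⟩ := exists_projChart p
  exact ⟨e, he, he p hp ▸ e.map_target hp⟩

instance chartedSpaceM77 : ChartedSpace R77 M77 where
  atlas := projCharts
  chartAt x := (exists_projChart_source x).choose
  mem_chart_source x := (exists_projChart_source x).choose_spec.2
  chart_mem_atlas x := (exists_projChart_source x).choose_spec.1

theorem symm_apply_eq_proj77 {e : OpenPartialHomeomorph M77 R77} (he : e ∈ atlas R77 M77) {y : R77}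
    (hy : y ∈ e.target) : e.symm y = proj77 y :=
  he y hy

theorem proj77_chart {e : OpenPartialHomeomorph M77 R77} (he : e ∈ atlas R77 M77) {x : M77}
    (hx : x ∈ e.source) : proj77 (e x) = x := by
  rw [← symm_apply_eq_proj77 he (e.map_source hx), e.left_inv hx]

/-- In the charts of the quotient, the projection is locally given by elements of `Γ77`. -/
theorem exists_eventually_chart_proj77 {e : OpenPartialHomeomorph M77 R77}
    (he : e ∈ atlas R77 M77) {q : R77} (hq : proj77 q ∈ e.source) :
    ∃ γ : Γ77, ∀ᶠ q' in 𝓝 q, e (proj77 q') = γ.1 q' := by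
  have hcont : ContinuousAt (fun q' => e (proj77 q')) q :=
    (e.continuousAt hq).comp isLocalHomeomorph_proj77.continuous.continuousAt
  obtain ⟨γ, hγ⟩ := proj77_eq_iff.mp (proj77_chart he hq)
  refine ⟨γ, ?_⟩
  -- Both `e ∘ proj77` and γ are continuous lifts of the projection that agree at q. Near their
  -- common value the projection is injective, so they agree near q.
  obtain ⟨e', hy, he'⟩ := isLocalHomeomorph_proj77 (e (proj77 q))
  have hU := e'.open_source.mem_nhds hy
  have h₁ := hcont.eventually_mem hU
  have h₂ : ∀ᶠ q' in 𝓝 q, γ.1 q' ∈ e'.source :=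
    (AffineEquiv.continuous_R77 γ.1).continuousAt.eventually_mem (by rwa [hγ])
  have h₃ : ∀ᶠ q' in 𝓝 q, proj77 q' ∈ e.source :=
    isLocalHomeomorph_proj77.continuous.continuousAt.eventually_mem (e.open_source.mem_nhds hq)
  filter_upwards [h₁, h₂, h₃] with q' k₁ k₂ k₃
  refine e'.injOn k₁ k₂ ?_
  rw [← he', proj77_chart he k₃]
  exact (proj77_eq_iff.mpr ⟨γ, rfl⟩).symm

/-- The linear part of an affine automorphism, as a continuous linear map. -/
def linCLM (f : R77 ≃ᵃ[ℝ] R77) : R77 →L[ℝ] R77 :=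
  LinearMap.toContinuousLinearMap f.linear.toLinearMap

theorem AffineEquiv.apply_eq_linear_add (f : R77 ≃ᵃ[ℝ] R77) (p : R77) :
    f p = f.linear p + f 0 := by
  simpa using f.map_vadd 0 p

theorem AffineEquiv.hasFDerivAt_R77 (f : R77 ≃ᵃ[ℝ] R77) (p : R77) :
    HasFDerivAt f (linCLM f) p := by
  have h : (f : R77 → R77) = fun q => linCLM f q + f 0 := funext f.apply_eq_linear_add
  rw [h]
  exact (linCLM f).hasFDerivAt.add_const _

theorem AffineEquiv.contDiff_R77 (f : R77 ≃ᵃ[ℝ] R77) : ContDiff ℝ ∞ f := by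
  have h : (f : R77 → R77) = fun q => linCLM f q + f 0 := funext f.apply_eq_linear_add
  rw [h]
  exact (linCLM f).contDiff.add contDiff_const

instance isManifoldM77 : IsManifold 𝓘(ℝ, R77) ∞ M77 := by
  refine isManifold_of_contDiffOn _ _ _ fun e e' he he' => ?_
  intro y hy
  simp only [mfld_simps] at hy
  obtain ⟨hy₁, hy₂⟩ := hy
  rw [symm_apply_eq_proj77 he hy₁] at hy₂
  obtain ⟨γ, hγ⟩ := exists_eventually_chart_proj77 he' hy₂
  refine ContDiffAt.contDiffWithinAt ?_
  refine (AffineEquiv.contDiff_R77 γ.1).contDiffAt.congr_of_eventuallyEq ?_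
  filter_upwards [hγ, e.open_target.mem_nhds hy₁] with z hz hz'
  simp only [mfld_simps]
  rw [symm_apply_eq_proj77 he hz', hz]

theorem contMDiffOn_of_mem_atlas {e : OpenPartialHomeomorph M77 R77} (he : e ∈ atlas R77 M77) :
    ContMDiffOn 𝓘(ℝ, R77) 𝓘(ℝ, R77) ∞ e e.source :=
  contMDiffOn_of_mem_maximalAtlas (IsManifold.subset_maximalAtlas he)

theorem contMDiffOn_symm_of_mem_atlas {e : OpenPartialHomeomorph M77 R77}
    (he : e ∈ atlas R77 M77) : ContMDiffOn 𝓘(ℝ, R77) 𝓘(ℝ, R77) ∞ e.symm e.target :=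
  contMDiffOn_symm_of_mem_maximalAtlas (IsManifold.subset_maximalAtlas he)

theorem isLocalDiffeomorph_proj77 :
    IsLocalDiffeomorph 𝓘(ℝ, R77) 𝓘(ℝ, R77) ∞ proj77 := by
  intro p
  obtain ⟨e, he, hp⟩ := exists_projChart p
  exact ⟨{ e.symm.toPartialEquiv with
    open_source := e.open_target
    open_target := e.open_source
    contMDiffOn_toFun := contMDiffOn_symm_of_mem_atlas he
    contMDiffOn_invFun := contMDiffOn_of_mem_atlas he }, hp, fun y hy => (he y hy).symm⟩

theorem contMDiff_proj77 : ContMDiff 𝓘(ℝ, R77) 𝓘(ℝ, R77) ∞ proj77 :=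
  isLocalDiffeomorph_proj77.contMDiff

/-- Tangent vectors of M at `proj77 p` are read in the preferred chart there, which need not send
`proj77 p` back to p. So the derivative is the linear part of some element of Γ, not necessarily the
identity. -/
theorem exists_hasMFDerivAt_proj77 (p : R77) : ∃ γ : Γ77,
    HasMFDerivAt 𝓘(ℝ, R77) 𝓘(ℝ, R77) proj77 p (linCLM γ.1) := by
  obtain ⟨γ, hγ⟩ := exists_eventually_chart_proj77 (chart_mem_atlas R77 (proj77 p))
    (mem_chart_source R77 (proj77 p))
  refine ⟨γ, isLocalHomeomorph_proj77.continuous.continuousAt, ?_⟩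
  exact ((AffineEquiv.hasFDerivAt_R77 γ.1 p).congr_of_eventuallyEq hγ).hasFDerivWithinAt

theorem form77_linear {f : R77 ≃ᵃ[ℝ] R77} (hf : f ∈ Iso77) (p q : R77) :
    form77 (f.linear p) (f.linear q) = form77 p q :=
  hf p q

/-! ### The metric of the quotient -/

/-- `form77` as a continuous bilinear map. -/
def form77CLM : R77 →L[ℝ] R77 →L[ℝ] ℝ :=
  LinearMap.toContinuousLinearMap
    ((LinearMap.toContinuousLinearMap : (R77 →ₗ[ℝ] ℝ) ≃ₗ[ℝ] (R77 →L[ℝ] ℝ)).toLinearMap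
      ∘ₗ form77Bilin)

/-- The coordinate changes of the tangent bundle of `M` preserve `form77`. -/
theorem form77_coordChange {x₀ x : M77} (hx : x ∈ (chartAt R77 x₀).source) (u v : R77) :
    form77 (tangentCoordChange 𝓘(ℝ, R77) x₀ x x u) (tangentCoordChange 𝓘(ℝ, R77) x₀ x x v)
      = form77 u v := by
  have he := chart_mem_atlas R77 x₀
  have hp : proj77 (chartAt R77 x₀ x) = x := proj77_chart he hx
  have hs : proj77 (chartAt R77 x₀ x) ∈ (chartAt R77 x).source := by
    rw [hp]; exact mem_chart_source R77 x
  obtain ⟨γ, hγ⟩ := exists_eventually_chart_proj77 (chart_mem_atlas R77 x) hs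
  have hd : tangentCoordChange 𝓘(ℝ, R77) x₀ x x = linCLM γ.1 := by
    rw [tangentCoordChange_def]
    simp only [mfld_simps, fderivWithin_univ]
    refine HasFDerivAt.fderiv ((AffineEquiv.hasFDerivAt_R77 γ.1 _).congr_of_eventuallyEq ?_)
    filter_upwards [hγ, (chartAt R77 x₀).open_target.mem_nhds ((chartAt R77 x₀).map_source hx)]
      with z hz hz'
    simp only [Function.comp_apply]
    rw [symm_apply_eq_proj77 he hz', hz]
  rw [hd]
  exact form77_linear (Γ77_le_Iso77 γ.2) u v

/-- In the trivialization at x₀ this section is constant, because the coordinate changes of the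
tangent bundle are linear isometries. -/
theorem contMDiff_form77CLM :
    ContMDiff 𝓘(ℝ, R77) (𝓘(ℝ, R77).prod 𝓘(ℝ, R77 →L[ℝ] R77 →L[ℝ] ℝ)) ∞
    (fun x : M77 => Bundle.TotalSpace.mk' (R77 →L[ℝ] R77 →L[ℝ] ℝ)
      (E := fun x : M77 => TangentSpace 𝓘(ℝ, R77) x →L[ℝ] TangentSpace 𝓘(ℝ, R77) x →L[ℝ] ℝ)
      x form77CLM) := by
  intro x₀
  refine (Bundle.contMDiffAt_section _).mpr ?_
  refine (contMDiffAt_const (c := form77CLM)).congr_of_eventuallyEq ?_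
  filter_upwards [(chartAt R77 x₀).open_source.mem_nhds (mem_chart_source R77 x₀)] with x hx
  refine ContinuousLinearMap.ext fun u => ContinuousLinearMap.ext fun v => ?_
  refine Eq.trans ?_ (form77_coordChange hx u v)
  have hb : x ∈ (trivializationAt R77 (TangentSpace 𝓘(ℝ, R77) : M77 → Type) x₀).baseSet := by
    rwa [TangentBundle.trivializationAt_baseSet]
  refine (inCoordinates_apply_eq₂ (E₃ := Bundle.Trivial M77 ℝ) hb hb (Set.mem_univ x)).trans ?_
  have hs : ∀ w : R77, (trivializationAt R77 (TangentSpace 𝓘(ℝ, R77) : M77 → Type) x₀).symm x w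
      = tangentCoordChange 𝓘(ℝ, R77) x₀ x x w := fun w =>
    (Bundle.Trivialization.symmL_apply _ hb w).symm.trans <|
      congrArg (fun L : R77 →L[ℝ] R77 => L w)
      (TangentBundle.symmL_trivializationAt_eq_core (I := 𝓘(ℝ, R77)) hx)
  rw [hs u, hs v]
  simp only [Bundle.Trivial.fiberBundle_trivializationAt',
    Bundle.Trivial.linearMapAt_trivialization]
  rfl

/-- The metric of `M` induced by the scalar product of `ℝ^{7,7}`. -/
def metric77 : PseudoRiemannianMetric R77 M77 where
  val _ := form77CLM
  symm _ u v := form77_comm u v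
  nondegenerate _ u hu := form77_nondegenerate u hu
  contMDiff := contMDiff_form77CLM

theorem metric77_val (x : M77) (u v : TangentSpace 𝓘(ℝ, R77) x) :
    metric77.val x u v = form77 u v := rfl

theorem metric77_proj77 (p : R77) (u v : TangentSpace 𝓘(ℝ, R77) p) :
    metric77.val (proj77 p) (mfderiv 𝓘(ℝ, R77) 𝓘(ℝ, R77) proj77 p u)
      (mfderiv 𝓘(ℝ, R77) 𝓘(ℝ, R77) proj77 p v) = form77 u v := by
  obtain ⟨γ, hγ⟩ := exists_hasMFDerivAt_proj77 p
  rw [hγ.mfderiv, metric77_val]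
  exact form77_linear (Γ77_le_Iso77 γ.2) u v

/-- Near y the inverse chart is the projection, whose derivative lies in the holonomy group and so
preserves the scalar product. -/
theorem metric77_inChart {e : OpenPartialHomeomorph M77 R77} (he : e ∈ atlas R77 M77) {y : R77}
    (hy : y ∈ e.target) : metric77.inChart e y = form77CLM := by
  obtain ⟨γ, hγ⟩ := exists_hasMFDerivAt_proj77 y
  have h : HasMFDerivAt 𝓘(ℝ, R77) 𝓘(ℝ, R77) e.symm y (linCLM γ.1) :=
    hγ.congr_of_eventuallyEq (by
      filter_upwards [e.open_target.mem_nhds hy] with z hz using symm_apply_eq_proj77 he hz)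
  refine ContinuousLinearMap.ext fun u => ContinuousLinearMap.ext fun v => ?_
  rw [PseudoRiemannianMetric.inChart, h.mfderiv]
  exact form77_linear (Γ77_le_Iso77 γ.2) u v

theorem metric77_christoffel {e : OpenPartialHomeomorph M77 R77} (he : e ∈ atlas R77 M77) {y : R77}
    (hy : y ∈ e.target) (u v : R77) : christoffel (metric77.inChart e) y u v = 0 := by
  have h : metric77.inChart e =ᶠ[𝓝 y] fun _ => form77CLM := by
    filter_upwards [e.open_target.mem_nhds hy] with z hz using metric77_inChart he hz
  have h' : fderiv ℝ (metric77.inChart e) y = 0 := by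
    rw [h.fderiv_eq, fderiv_fun_const]; rfl
  simp [christoffel, h']

theorem metric77_isFlat : metric77.IsFlat := by
  intro e he y hy u v w
  have h : ∀ a b : R77, fderiv ℝ (fun z => christoffel (metric77.inChart e) z a b) y = 0 := by
    intro a b
    have h₁ : (fun z => christoffel (metric77.inChart e) z a b) =ᶠ[𝓝 y] fun _ => 0 := by
      filter_upwards [e.open_target.mem_nhds hy] with z hz using metric77_christoffel he hz a b
    rw [h₁.fderiv_eq, fderiv_fun_const]; rfl
  simp [riemannCurvature, h, metric77_christoffel he hy]

theorem metric77_hasConstSignature : metric77.HasConstSignature 7 7 :=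
  fun _ => hasSignature_form77

/-! ### Geodesic completeness -/

theorem hasDerivAt_affine_line (f : R77 ≃ᵃ[ℝ] R77) (p w : R77) (t : ℝ) :
    HasDerivAt (fun s : ℝ => f (p + s • w)) (f.linear w) t := by
  have h : HasDerivAt (fun s : ℝ => p + s • w) w t := by
    simpa using ((hasDerivAt_id t).smul_const w).const_add p
  exact (f.hasFDerivAt_R77 _).comp_hasDerivAt t h

theorem contMDiff_line (p w : R77) :
    ContMDiff 𝓘(ℝ, ℝ) 𝓘(ℝ, R77) ∞ (fun s : ℝ => p + s • w) :=
  (contDiff_const.add (contDiff_id.smul contDiff_const)).contMDiff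

theorem metric77_isGeodesic (p w : R77) :
    metric77.IsGeodesic (fun t : ℝ => proj77 (p + t • w)) := by
  refine ⟨contMDiff_proj77.comp (contMDiff_line p w), fun e he t ht => ?_⟩
  rw [metric77_christoffel he (e.map_source ht), add_zero]
  obtain ⟨γ, hγ⟩ := exists_eventually_chart_proj77 he ht
  have hcont : ContinuousAt (fun s : ℝ => p + s • w) t := by fun_prop
  have h : (e ∘ fun s : ℝ => proj77 (p + s • w)) =ᶠ[𝓝 t] fun s => γ.1 (p + s • w) :=
    hcont.eventually hγ
  have h' : deriv (fun s : ℝ => γ.1 (p + s • w)) = fun _ => γ.1.linear w :=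
    funext fun s => (hasDerivAt_affine_line γ.1 p w s).deriv
  rw [h.deriv.deriv_eq, h', deriv_const]

/-- All fibres are definitionally `R77`, so vectors over propositionally equal base points compare
without transport. -/
theorem TangentBundle.mk_eq_mk {x y : M77} (h : x = y) {u v : R77} (h' : u = v) :
    (⟨x, u⟩ : TangentBundle 𝓘(ℝ, R77) M77) = ⟨y, v⟩ := by
  subst h h'
  rfl

theorem metric77_isComplete : metric77.IsComplete := by
  rintro ⟨x, v⟩
  obtain ⟨p, rfl⟩ := proj77_surjective x
  have h0 : ∀ w : R77, p + (0 : ℝ) • w = p := fun w => by simp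
  obtain ⟨γ, hγ⟩ := exists_hasMFDerivAt_proj77 p
  -- The direction upstairs that the derivative of the projection sends to v.
  let w : R77 := γ.1.linear.symm v
  refine ⟨_, metric77_isGeodesic p w, TangentBundle.mk_eq_mk (congrArg proj77 (h0 w)) ?_⟩
  have hl : HasMFDerivAt 𝓘(ℝ, ℝ) 𝓘(ℝ, R77) (fun s : ℝ => p + s • w) 0
      (ContinuousLinearMap.toSpanSingleton ℝ w) := by
    have h : HasDerivAt (fun s : ℝ => p + s • w) w 0 := by
      simpa using ((hasDerivAt_id (0 : ℝ)).smul_const w).const_add p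
    exact h.hasFDerivAt.hasMFDerivAt
  -- The line starts at `p + 0 • w`, which equals p only propositionally.
  have hγ' : ∀ q, q = p → HasMFDerivAt 𝓘(ℝ, R77) 𝓘(ℝ, R77) proj77 q (linCLM γ.1) := by
    rintro _ rfl
    exact hγ
  have hc := HasMFDerivAt.comp (0 : ℝ) (hγ' _ (h0 w)) hl
  have h₁ := hc.mfderiv
  change mfderiv 𝓘(ℝ, ℝ) 𝓘(ℝ, R77) (proj77 ∘ fun s : ℝ => p + s • w) 0 (1 : ℝ) = v
  rw [h₁]
  exact (congrArg γ.1.linear (one_smul ℝ w)).trans (γ.1.linear.apply_symm_apply v)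

/-! ### Homogeneity -/

theorem centralIso_comm {f : R77 ≃ᵃ[ℝ] R77} (hf : f ∈ centralIso) (γ : Γ77) (p : R77) :
    f (γ.1 p) = γ.1 (f p) :=
  (congrArg (fun g : R77 ≃ᵃ[ℝ] R77 => g p)
    (Subgroup.mem_centralizer_iff.mp hf.1 γ.1 γ.2)).symm

/-- The transformation of `M` induced by an affine transformation commuting with `Γ77`. -/
def descend (f : R77 ≃ᵃ[ℝ] R77) (hf : f ∈ centralIso) : M77 → M77 :=
  Quotient.lift (fun p => proj77 (f p)) (by
    rintro _ q ⟨γ, rfl⟩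
    exact proj77_eq_iff.mpr ⟨γ, (centralIso_comm hf γ q).symm⟩)

theorem descend_proj77 (f : R77 ≃ᵃ[ℝ] R77) (hf : f ∈ centralIso) (p : R77) :
    descend f hf (proj77 p) = proj77 (f p) := rfl

theorem contMDiff_descend (f : R77 ≃ᵃ[ℝ] R77) (hf : f ∈ centralIso) :
    ContMDiff 𝓘(ℝ, R77) 𝓘(ℝ, R77) ∞ (descend f hf) := by
  intro x
  have hx := (chartAt R77 x).open_source.mem_nhds (mem_chart_source R77 x)
  have h : ContMDiffAt 𝓘(ℝ, R77) 𝓘(ℝ, R77) ∞ (proj77 ∘ f ∘ chartAt R77 x) x :=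
    ((contMDiff_proj77.comp f.contDiff_R77.contMDiff) _).comp x
      ((contMDiffOn_of_mem_atlas (chart_mem_atlas R77 x)).contMDiffAt hx)
  refine h.congr_of_eventuallyEq ?_
  filter_upwards [hx] with z hz
  conv_lhs => rw [← proj77_chart (chart_mem_atlas R77 x) hz]
  rfl

/-- The diffeomorphism of `M` induced by an affine transformation commuting with `Γ77`. -/
def descendDiffeo (f : R77 ≃ᵃ[ℝ] R77) (hf : f ∈ centralIso) :
    M77 ≃ₘ^∞⟮𝓘(ℝ, R77), 𝓘(ℝ, R77)⟯ M77 where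
  toFun := descend f hf
  invFun := descend f⁻¹ (inv_mem hf)
  left_inv x := by
    obtain ⟨p, rfl⟩ := proj77_surjective x
    rw [descend_proj77, descend_proj77]
    exact congrArg proj77 (f.symm_apply_apply p)
  right_inv x := by
    obtain ⟨p, rfl⟩ := proj77_surjective x
    rw [descend_proj77, descend_proj77]
    exact congrArg proj77 (f.apply_symm_apply p)
  contMDiff_toFun := contMDiff_descend f hf
  contMDiff_invFun := contMDiff_descend f⁻¹ (inv_mem hf)

/-- Chain rule applied to both sides of `descend f hf ∘ proj77 = proj77 ∘ f`. The result is a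
composite of three linear isometries. -/
theorem mfderiv_descend {f : R77 ≃ᵃ[ℝ] R77} (hf : f ∈ centralIso) {p : R77} {γ δ : Γ77}
    (hγ : HasMFDerivAt 𝓘(ℝ, R77) 𝓘(ℝ, R77) proj77 p (linCLM γ.1))
    (hδ : HasMFDerivAt 𝓘(ℝ, R77) 𝓘(ℝ, R77) proj77 (f p) (linCLM δ.1)) (u : R77) :
    (mfderiv 𝓘(ℝ, R77) 𝓘(ℝ, R77) (descend f hf) (proj77 p) u : R77)
      = δ.1.linear (f.linear (γ.1.linear.symm u)) := by
  have hF : HasMFDerivAt 𝓘(ℝ, R77) 𝓘(ℝ, R77) (descend f hf) (proj77 p)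
      (mfderiv 𝓘(ℝ, R77) 𝓘(ℝ, R77) (descend f hf) (proj77 p)) :=
    ((contMDiff_descend f hf (proj77 p)).mdifferentiableAt (by simp)).hasMFDerivAt
  have h₁ := HasMFDerivAt.comp p hF hγ
  have h₂ := HasMFDerivAt.comp p hδ (f.hasFDerivAt_R77 p).hasMFDerivAt
  have h := hasMFDerivAt_unique (f := proj77 ∘ f) h₁ h₂
  have h₃ := congrArg (fun L : R77 →L[ℝ] R77 => L (γ.1.linear.symm u)) h
  refine Eq.trans (congrArg _ ?_) h₃
  exact (γ.1.linear.apply_symm_apply u).symm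

theorem form77_mfderiv_descend {f : R77 ≃ᵃ[ℝ] R77} (hf : f ∈ centralIso) (p u v : R77) :
    form77 (mfderiv 𝓘(ℝ, R77) 𝓘(ℝ, R77) (descend f hf) (proj77 p) u)
      (mfderiv 𝓘(ℝ, R77) 𝓘(ℝ, R77) (descend f hf) (proj77 p) v) = form77 u v := by
  obtain ⟨γ, hγ⟩ := exists_hasMFDerivAt_proj77 p
  obtain ⟨δ, hδ⟩ := exists_hasMFDerivAt_proj77 (f p)
  refine (congrArg₂ form77 (mfderiv_descend hf hγ hδ u) (mfderiv_descend hf hγ hδ v)).trans ?_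
  rw [form77_linear (Γ77_le_Iso77 δ.2), form77_linear hf.2,
    ← form77_linear (Γ77_le_Iso77 γ.2), LinearEquiv.apply_symm_apply,
    LinearEquiv.apply_symm_apply]

theorem metric77_isIsometry (f : R77 ≃ᵃ[ℝ] R77) (hf : f ∈ centralIso) :
    metric77.IsIsometry (descendDiffeo f hf) := by
  intro x u v
  obtain ⟨p, rfl⟩ := proj77_surjective x
  exact form77_mfderiv_descend hf p u v

theorem metric77_isHomogeneous : metric77.IsHomogeneous := by
  intro x y
  obtain ⟨p, rfl⟩ := proj77_surjective x
  obtain ⟨q, rfl⟩ := proj77_surjective y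
  obtain ⟨f, hf, hfp⟩ := centralIso_transitive p q
  exact ⟨descendDiffeo f hf, metric77_isIsometry f hf,
    (descend_proj77 f hf p).trans (congrArg proj77 hfp)⟩

end

theorem mainTheorem4 :
    HasSignature form77 7 7 ∧
    Γ77 ≤ Iso77 ∧
    Nonempty (Γ77 ≃* heisenbergGroup) ∧
    (∀ p q : R77, ∃ f ∈ Subgroup.centralizer (Γ77 : Set (R77 ≃ᵃ[ℝ] R77)) ⊓ Iso77, f p = q) ∧
    (∀ γ ∈ Γ77, ∀ p : R77, γ p = p → γ = 1) ∧
    ProperlyDiscontinuousSMul Γ77 R77 ∧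
    (¬ ∀ a ∈ linearHolonomy Γ77, ∀ b ∈ linearHolonomy Γ77, a * b = b * a) ∧
    T2Space M77 ∧ SecondCountableTopology M77 ∧ ConnectedSpace M77 ∧
    ∃ (_ : ChartedSpace R77 M77) (_ : IsManifold 𝓘(ℝ, R77) ∞ M77)
      (g : PseudoRiemannianMetric R77 M77),
      IsLocalDiffeomorph 𝓘(ℝ, R77) 𝓘(ℝ, R77) ∞ proj77 ∧
      (∀ (p : R77) (u v : TangentSpace 𝓘(ℝ, R77) p),
        g.val (proj77 p) (mfderiv 𝓘(ℝ, R77) 𝓘(ℝ, R77) proj77 p u)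
          (mfderiv 𝓘(ℝ, R77) 𝓘(ℝ, R77) proj77 p v) = form77 u v) ∧
      g.HasConstSignature 7 7 ∧ g.IsFlat ∧ g.IsComplete ∧ g.IsHomogeneous := by
  exact ⟨hasSignature_form77, Γ77_le_Iso77, ⟨Γ77EquivHeisenberg⟩, centralIso_transitive,
    fun _ h _ hp => Γ77_free h hp, inferInstance, linearHolonomy_not_comm, inferInstance,
    inferInstance, inferInstance, chartedSpaceM77, isManifoldM77, metric77,
    isLocalDiffeomorph_proj77, metric77_proj77, metric77_hasConstSignature, metric77_isFlat,
    metric77_isComplete, metric77_isHomogeneous⟩
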